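/- Let $G=(A\cup B,E)$ be a finite bipartite graph of men $A$ and women $B$. Each man $a$ has a strict preference list of his neighbours $N(a)$, and each woman has a preference list of her neighbours that may contain ties. A pair $(a,b)\in E\setminus M$ is blocking for a matching $M$ if each of $a$, $b$ is unmatched in $M$ or strictly prefers the other one to the current partner; $M$ is stable if no pair is blocking. Consider the algorithm of Huang and Telikepalli. Each man $a$ has two proposals, both addressed at first to the first woman on his list. He is basic until every woman in $N(a)$ has rejected a proposal of his at least once, then $1$-promoted until every woman in $N(a)$ has rejected a proposal of his while he was $1$-promoted, and $2$-promoted from then on; once every woman in $N(a)$ has rejected a proposal of his while he was $2$-promoted, he stops making proposals. As long as there is a proposal that no woman holds, of a man who has not stopped, one such proposal (chosen arbitrarily) is made to the woman $b$ to whom it is addressed. If $b$ holds at most one other proposal, she accepts it. If she already holds two, she keeps two of the three proposals and rejects one that is not superior to any of the three (chosen arbitrarily); the rejected proposal is then addressed to the next woman on its man's list, cyclically. Here a proposal of $a$ is superior to one of $a'$ for $b$ if $b$ prefers $a$ to $a'$, or if $b$ is indifferent between them and either $a$ is $2$-promoted and $a'$ is not, or $a$ is $1$-promoted and $a'$ is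 basic, or both are basic and $b$ has already rejected a proposal of $a$ but none of $a'$. When no further proposal can be made, let $G'$ be the graph of the pairs $(a,b)$ such that $b$ holds a proposal of $a$. The algorithm outputs a maximum-cardinality matching $M$ of $G'$ that matches every node of degree $2$ in $G'$. This algorithm is a $\frac{13}{9}$-approximation algorithm for the maximum-cardinality stable matching problem with one-sided ties: for all arbitrary choices, the proposal phase ends after at most $6|E|$ proposals, a matching $M$ as required exists, and every such $M$ is a stable matching of $G$ with $|\mathrm{OPT}|\le\frac{13}{9}|M|$, where $\mathrm{OPT}$ is a stable matching of $G$ of maximum cardinality. -/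

import Mathlib

namespace StableMarriage

/-- An instance of stable marriage with ties on the women's side only.  `menList a` is the strict
preference list of the man `a`, from the most to the least preferred acceptable woman; the pair
`(a, b)` is an edge iff `b` occurs in it.  `rank b a` is the index of the tie class of `a` on the
list of the woman `b` (smaller is better, equal means indifferent); it is only ever used for men
`a` adjacent to `b`. -/
structure Market (A B : Type*) where
  menList : A → List B
  nodup : ∀ a, (menList a).Nodup
  rank : B → A → ℕ

/-- The three statuses of a man. -/
inductive Status where
  | basic
  | onePromoted
  | twoPromoted
  deriving DecidableEq

/-- A state of the proposal phase.  The proposal `(a, i)`, `i : Fin 2`, of the man `a` is addressed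
to the woman at index `pos (a, i)` of his list, and `held` is the set of the proposals that are
currently held by the women they are addressed to.  `rejections` contains `(a, b, σ)` iff `b` has
rejected at least once a proposal of `a` at a moment at which `a` had the status `σ`. -/
structure State (A B : Type*) where
  pos : A × Fin 2 → ℕ
  held : Finset (A × Fin 2)
  rejections : Finset (A × B × Status)

section

variable {A B : Type*} [Fintype A] [Fintype B] [DecidableEq A] [DecidableEq B]

/-! ### Stable matchings -/

/-- The edge set of the bipartite graph `G`. -/
def Market.edges (I : Market A B) : Finset (A × B) :=
  Finset.univ.filter fun e => e.2 ∈ I.menList e.1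

/-- The man `a` strictly prefers `b` to `b'`. -/
def Market.manPrefers (I : Market A B) (a : A) (b b' : B) : Prop :=
  (I.menList a).idxOf b < (I.menList a).idxOf b'

/-- The woman `b` strictly prefers `a` to `a'`. -/
def Market.womanPrefers (I : Market A B) (b : B) (a a' : A) : Prop :=
  I.rank b a < I.rank b a'

/-- The woman `b` is indifferent between `a` and `a'`. -/
def Market.indifferent (I : Market A B) (b : B) (a a' : A) : Prop :=
  I.rank b a = I.rank b a'

/-- `M` is a matching in the bipartite graph with edge set `F`. -/
def IsMatching (F M : Finset (A × B)) : Prop :=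
  M ⊆ F ∧ ∀ e ∈ M, ∀ f ∈ M, e.1 = f.1 ∨ e.2 = f.2 → e = f

/-- `M` is a matching of maximum cardinality in the bipartite graph with edge set `F`. -/
def IsMaximumMatching (F M : Finset (A × B)) : Prop :=
  IsMatching F M ∧ ∀ N, IsMatching F N → N.card ≤ M.card

/-- `(a, b)` is a blocking pair for `M`: it is an edge outside of `M`, each of `a` and `b` is
unmatched or strictly prefers the other one to the current partner. -/
def Market.IsBlockingPair (I : Market A B) (M : Finset (A × B)) (a : A) (b : B) : Prop :=
  (a, b) ∈ I.edges ∧ (a, b) ∉ M ∧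
    (∀ b', (a, b') ∈ M → I.manPrefers a b b') ∧
    (∀ a', (a', b) ∈ M → I.womanPrefers b a a')

/-- `M` is a stable matching in `G`. -/
def Market.IsStable (I : Market A B) (M : Finset (A × B)) : Prop :=
  IsMatching I.edges M ∧ ∀ a b, ¬ I.IsBlockingPair M a b

/-- `M` is a stable matching of maximum cardinality in `G`. -/
def Market.IsMaximumStable (I : Market A B) (M : Finset (A × B)) : Prop :=
  I.IsStable M ∧ ∀ N, I.IsStable N → N.card ≤ M.card

/-! ### The proposal phase -/

/-- Every woman on the list of `a` has rejected a proposal of `a` as a man of status `σ`. -/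
def State.rejectedByAll (I : Market A B) (s : State A B) (a : A) (σ : Status) : Prop :=
  ∀ b ∈ I.menList a, (a, b, σ) ∈ s.rejections

instance (I : Market A B) (s : State A B) (a : A) (σ : Status) :
    Decidable (s.rejectedByAll I a σ) := by
  unfold State.rejectedByAll
  infer_instance

/-- The current status of `a`: he is basic until every woman on his list has rejected him, then
`1`-promoted until every woman on his list has rejected him as a `1`-promoted man, and
`2`-promoted from then on. -/
def State.status (I : Market A B) (s : State A B) (a : A) : Status :=
  if s.rejectedByAll I a .basic then
    if s.rejectedByAll I a .onePromoted then .twoPromoted else .onePromoted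
  else .basic

/-- The man `a` has stopped making proposals: he is `2`-promoted, and every woman on his list has
rejected him as a `2`-promoted man. -/
def State.stopped (I : Market A B) (s : State A B) (a : A) : Prop :=
  s.status I a = .twoPromoted ∧ s.rejectedByAll I a .twoPromoted

/-- The proposals that the woman `b` currently holds. -/
def State.holds (I : Market A B) (s : State A B) (b : B) : Finset (A × Fin 2) :=
  s.held.filter fun p => (I.menList p.1)[s.pos p]? = some b

/-- For the woman `b`, a proposal of `a` is superior to a proposal of `a'`. -/
def State.superior (I : Market A B) (s : State A B) (b : B) (a a' : A) : Prop :=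
  I.womanPrefers b a a' ∨
  (I.indifferent b a a' ∧
    s.status I a = .twoPromoted ∧ s.status I a' ≠ .twoPromoted) ∨
  (I.indifferent b a a' ∧
    s.status I a = .onePromoted ∧ s.status I a' = .basic) ∨
  (I.indifferent b a a' ∧ s.status I a = .basic ∧ s.status I a' = .basic ∧
    (∃ σ, (a, b, σ) ∈ s.rejections) ∧ ¬ ∃ σ, (a', b, σ) ∈ s.rejections)

/-- For the woman `b`, `q` is a least desirable proposal in the set `S`. -/
def State.leastDesirable (I : Market A B) (s : State A B) (b : B) (S : Finset (A × Fin 2))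
    (q : A × Fin 2) : Prop :=
  q ∈ S ∧ ∀ r ∈ S, ¬ s.superior I b q.1 r.1

/-- The initial state: no proposal has been made, and both proposals of each man are addressed to
the first woman on his list. -/
def State.initial : State A B where
  pos := fun _ => 0
  held := ∅
  rejections := ∅

/-- The state after the proposal `p` has been accepted. -/
def State.accept (s : State A B) (p : A × Fin 2) : State A B where
  pos := s.pos
  held := insert p s.held
  rejections := s.rejections

/-- The state after the woman `b` has received the proposal `p` and has rejected the proposal `q`,
which is `p` or one of the proposals she held before: `q` is readdressed to the next woman on the
list, cyclically. -/
def State.reject (I : Market A B) (s : State A B) (p : A × Fin 2) (b : B) (q : A × Fin 2) :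
    State A B where
  pos := Function.update s.pos q ((s.pos q + 1) % (I.menList q.1).length)
  held := (insert p s.held).erase q
  rejections := insert (q.1, b, s.status I q.1) s.rejections

/-- The proposal `p`, which is not held by any woman and whose man has not stopped, is made to the
woman `b` to whom it is addressed. -/
def State.canPropose (I : Market A B) (s : State A B) (p : A × Fin 2) (b : B) : Prop :=
  p ∉ s.held ∧ ¬ s.stopped I p.1 ∧ (I.menList p.1)[s.pos p]? = some b

/-- One step of the proposal phase: one proposal, together with the reaction of the woman.  The
order of the proposals and the choice between several least desirable proposals are arbitrary. -/
inductive Step (I : Market A B) : State A B → State A B → Prop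
  | accept {s : State A B} {p : A × Fin 2} {b : B} (hp : s.canPropose I p b)
      (hb : (s.holds I b).card ≤ 1) : Step I s (s.accept p)
  | reject {s : State A B} {p : A × Fin 2} {b : B} {q : A × Fin 2} (hp : s.canPropose I p b)
      (hb : 2 ≤ (s.holds I b).card)
      (hq : s.leastDesirable I b (insert p (s.holds I b)) q) : Step I s (s.reject I p b q)

/-- `Run I n s`: the state `s` can be reached from the initial state by `n` steps, that is, with
`n` proposals made. -/
inductive Run (I : Market A B) : ℕ → State A B → Prop
  | zero : Run I 0 State.initial
  | succ {n : ℕ} {s t : State A B} (hs : Run I n s) (hst : Step I s t) : Run I (n + 1) t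

/-- The proposal phase has ended: every proposal that is not held belongs to a man who has stopped
making proposals. -/
def State.finished (I : Market A B) (s : State A B) : Prop :=
  ∀ p : A × Fin 2, p ∈ s.held ∨ s.stopped I p.1

/-! ### The output -/

/-- The edge set of the simple graph `G'` of the accepted proposals. -/
def State.accepted (I : Market A B) (s : State A B) : Finset (A × B) :=
  Finset.univ.filter fun e => ∃ i : Fin 2, (e.1, i) ∈ s.holds I e.2

/-- `M` matches every node that has degree two in the bipartite graph with edge set `F`. -/
def CoversDegreeTwo (F M : Finset (A × B)) : Prop :=
  (∀ a, (F.filter fun e => e.1 = a).card = 2 → ∃ b, (a, b) ∈ M) ∧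
  (∀ b, (F.filter fun e => e.2 = b).card = 2 → ∃ a, (a, b) ∈ M)

/-- `M` is a matching that the algorithm may output when its proposal phase ends in `s`. -/
def State.IsOutput (I : Market A B) (s : State A B) (M : Finset (A × B)) : Prop :=
  IsMaximumMatching (s.accepted I) M ∧ CoversDegreeTwo (s.accepted I) M

end

end StableMarriage

/-!
# The Huang–Telikepalli algorithm is a `13 / 9`-approximation algorithm

The proposal phase.  The order in which a woman compares proposals is given by a natural number,
`State.key`, which only decreases over time.  Since a woman always rejects a worst proposal, what
she holds never gets worse (`State.Bounded.step`); in particular she holds two proposals at least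
as good as anything she has ever rejected.  Counting the rejections of each proposal shows that a
proposal in its `k`-th round through the list, counted from `0`, belongs to a man who has been
promoted `k` times, so that a proposal is made at most three times to each woman (`State.Invariant`).

The output.  All degrees in the graph `G'` of the held proposals are at most two.  Hall's theorem
provides a matching of the men of degree two and one of the women of degree two, and the exchange
argument of Mendelsohn and Dulmage combines them with a maximum matching.  Stability holds because
every woman who holds two proposals is matched, and so is every man both of whose proposals are
held.

The approximation factor.  By König's theorem there is a vertex cover of `G'` that is not larger
than the output `M`, hence it suffices to pay for `9 |N|` with `13` units for each node of the
cover, where `N` is any stable matching of `G`.  The cost `9` of an edge `(a, b)` of `N` is split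
between its ends (`State.womanShare`): the share of `b` is `9` if `a` has stopped; else `5` if
everything held by `b` is at least as good as a proposal of `a` after a first rejection, as is the
case once she has rejected `a` twice; else `3` if she has rejected `a`, and `0` otherwise.

A woman of the cover pays, besides her own charge, for the proposals of men outside of the cover
that she holds: `2` if the man is `2`-promoted or prefers his partner in `N` to her, else `4` if she
has rejected him and `5` if she has not (`State.payment`).  This costs her at most `13`: if her
partner has stopped, then all men whose proposals she holds are of the first kind, since otherwise
`N` would have a blocking pair, and with a share of `5` none is of the last kind.  Conversely, the
payments cover the charge to a man: his share of `9` arises only if his partner has never rejected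
him, so that both proposals are addressed to women he likes at least as much, one of whom has never
rejected him; a share of `6` leaves at least one proposal at a woman he likes at least as much as
his partner.  Women outside of the cover are paid half of their charge for each of their two
proposals, by men of the cover, and the same case distinction shows that these men can afford it.
-/

namespace StableMarriage

/-! ### Matchings in bipartite graphs -/

section Matching

theorem IsMatching.card_image_fst {A B : Type*} [DecidableEq A] {F M : Finset (A × B)}
    (hM : IsMatching F M) :
    (M.image Prod.fst).card = M.card :=
  Finset.card_image_of_injOn fun e he f hf h => hM.2 e he f hf (Or.inl h)

theorem IsMatching.card_image_snd {A B : Type*} [DecidableEq B] {F M : Finset (A × B)}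
    (hM : IsMatching F M) :
    (M.image Prod.snd).card = M.card :=
  Finset.card_image_of_injOn fun e he f hf h => hM.2 e he f hf (Or.inr h)

variable {A B : Type*} [DecidableEq A] [DecidableEq B]

theorem IsMatching.insert_of_forall_ne {F M : Finset (A × B)} (hM : IsMatching F M) {e : A × B}
    (he : e ∈ F) (hfst : ∀ f ∈ M, f.1 ≠ e.1) (hsnd : ∀ f ∈ M, f.2 ≠ e.2) :
    IsMatching F (insert e M) := by
  refine ⟨Finset.insert_subset he hM.1, ?_⟩
  intro f hf g hg h
  rw [Finset.mem_insert] at hf hg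
  rcases hf with rfl | hf <;> rcases hg with rfl | hg
  · rfl
  · exact (h.elim (fun h => hfst g hg h.symm) fun h => hsnd g hg h.symm).elim
  · exact (h.elim (fun h => hfst f hf h) fun h => hsnd f hf h).elim
  · exact hM.2 f hf g hg h

theorem IsMatching.swap {F M : Finset (A × B)} (hM : IsMatching F M) :
    IsMatching (F.image Prod.swap) (M.image Prod.swap) := by
  refine ⟨Finset.image_subset_image hM.1, ?_⟩
  intro e he f hf h
  simp only [Finset.mem_image] at he hf
  obtain ⟨e, he, rfl⟩ := he
  obtain ⟨f, hf, rfl⟩ := hf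
  rw [hM.2 e he f hf h.symm]

/-- **Mendelsohn–Dulmage**: the men matched by `X` and the women matched by `Y` can be matched
simultaneously.  Among the matchings that match the women of `Y`, one that shares as many edges as
possible with `X` matches all men of `X`. -/
theorem exists_isMatching_image_subset {F X Y : Finset (A × B)} (hX : IsMatching F X)
    (hY : IsMatching F Y) :
    ∃ M, IsMatching F M ∧ X.image Prod.fst ⊆ M.image Prod.fst ∧
      Y.image Prod.snd ⊆ M.image Prod.snd := by
  classical
  obtain ⟨M, hM, hmax⟩ := Finset.exists_max_image
    (F.powerset.filter fun M => IsMatching F M ∧ Y.image Prod.snd ⊆ M.image Prod.snd)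
    (fun M => (M ∩ X).card)
    ⟨Y, Finset.mem_filter.2 ⟨Finset.mem_powerset.2 hY.1, hY, subset_rfl⟩⟩
  rw [Finset.mem_filter] at hM
  obtain ⟨-, hM, hMY⟩ := hM
  refine ⟨M, hM, ?_, hMY⟩
  intro a ha
  by_contra hna
  obtain ⟨⟨a, b⟩, hab, rfl⟩ := Finset.mem_image.1 ha
  have hne : ∀ f ∈ M, f.1 ≠ a := fun f hf h => hna (Finset.mem_image.2 ⟨f, hf, h⟩)
  -- Rematching `b` to `a` gains the edge `(a, b)` of `X` and loses no edge of `X`.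
  have hM' : IsMatching F (insert (a, b) (M.filter fun e => e.2 ≠ b)) := by
    refine IsMatching.insert_of_forall_ne
      ⟨(Finset.filter_subset _ _).trans hM.1, fun e he f hf => ?_⟩ (hX.1 hab) ?_ ?_
    · exact hM.2 e (Finset.mem_filter.1 he).1 f (Finset.mem_filter.1 hf).1
    · exact fun f hf => hne f (Finset.mem_filter.1 hf).1
    · exact fun f hf => (Finset.mem_filter.1 hf).2
  have hM'Y : Y.image Prod.snd ⊆
      (insert (a, b) (M.filter fun e => e.2 ≠ b)).image Prod.snd := by
    intro c hc
    obtain ⟨f, hf, rfl⟩ := Finset.mem_image.1 (hMY hc)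
    rw [Finset.mem_image]
    by_cases h : f.2 = b
    · exact ⟨(a, b), Finset.mem_insert_self _ _, h.symm⟩
    · exact ⟨f, Finset.mem_insert_of_mem (Finset.mem_filter.2 ⟨hf, h⟩), rfl⟩
  have hle := hmax _ (Finset.mem_filter.2 ⟨Finset.mem_powerset.2 hM'.1, hM', hM'Y⟩)
  refine absurd hle (not_le.2 (Finset.card_lt_card ⟨?_, ?_⟩))
  · intro f hf
    rw [Finset.mem_inter] at hf ⊢
    refine ⟨Finset.mem_insert_of_mem (Finset.mem_filter.2 ⟨hf.1, fun h => ?_⟩), hf.2⟩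
    exact hne f hf.1 (congrArg Prod.fst (hX.2 f hf.2 _ hab (Or.inr h)))
  · intro h
    have := h (Finset.mem_inter.2 ⟨Finset.mem_insert_self _ _, hab⟩)
    exact hne _ (Finset.mem_inter.1 this).1 rfl

/-- If no woman has degree more than two, then the men of degree two satisfy Hall's condition. -/
theorem exists_isMatching_of_card_filter_snd_le [Fintype A] {F : Finset (A × B)}
    (hF : ∀ b, (F.filter fun e => e.2 = b).card ≤ 2) :
    ∃ M, IsMatching F M ∧
      ∀ a, (F.filter fun e => e.1 = a).card = 2 → a ∈ M.image Prod.fst := by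
  classical
  let t : {a : A // (F.filter fun e => e.1 = a).card = 2} → Finset B := fun a =>
    (F.filter fun e => e.1 = a.1).image Prod.snd
  have hmem : ∀ a b, b ∈ t a ↔ (a.1, b) ∈ F := by
    intro a b
    simp only [t, Finset.mem_image, Finset.mem_filter]
    constructor
    · rintro ⟨⟨x, y⟩, ⟨h, rfl⟩, rfl⟩
      exact h
    · exact fun h => ⟨_, ⟨h, rfl⟩, rfl⟩
  have hcard : ∀ a, (t a).card = 2 := by
    intro a
    rw [Finset.card_image_of_injOn, a.2]
    intro e he f hf h
    simp only [Finset.coe_filter, Set.mem_ofPred_eq] at he hf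
    exact Prod.ext (he.2.trans hf.2.symm) h
  obtain ⟨f, hinj, hf⟩ := (Finset.all_card_le_biUnion_card_iff_exists_injective t).1 (by
    intro S
    have := Finset.card_mul_le_card_mul (fun a b => (a.1, b) ∈ F) (s := S) (t := S.biUnion t)
      (m := 2) (n := 2)
      (by
        intro a ha
        refine (hcard a).ge.trans (Finset.card_le_card fun b hb => ?_)
        rw [Finset.bipartiteAbove, Finset.mem_filter]
        exact ⟨Finset.mem_biUnion.2 ⟨a, ha, hb⟩, (hmem a b).1 hb⟩)
      (by
        intro b _
        refine le_trans ?_ (hF b)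
        refine Finset.card_le_card_of_injOn (fun a => (a.1, b)) ?_ ?_
        · intro a ha
          have := Finset.mem_coe.1 ha
          rw [Finset.bipartiteBelow, Finset.mem_filter] at this
          exact Finset.mem_coe.2 (Finset.mem_filter.2 ⟨this.2, rfl⟩)
        · intro a _ a' _ h
          exact Subtype.ext (congrArg Prod.fst h))
    omega)
  refine ⟨Finset.univ.image fun a => (a.1, f a), ⟨?_, ?_⟩, ?_⟩
  · intro e he
    obtain ⟨a, -, rfl⟩ := Finset.mem_image.1 he
    exact (hmem _ _).1 (hf a)
  · intro e he e' he' h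
    obtain ⟨a, -, rfl⟩ := Finset.mem_image.1 he
    obtain ⟨a', -, rfl⟩ := Finset.mem_image.1 he'
    have : a = a' := h.elim (fun h => Subtype.ext h) fun h => hinj h
    rw [this]
  · intro a ha
    exact Finset.mem_image.2 ⟨_, Finset.mem_image.2 ⟨⟨a, ha⟩, Finset.mem_univ _, rfl⟩, rfl⟩

/-- In a bipartite graph without nodes of degree more than two, some maximum matching matches
every node of degree two. -/
theorem exists_isMaximumMatching_coversDegreeTwo [Fintype A] [Fintype B] {F : Finset (A × B)}
    (hA : ∀ a, (F.filter fun e => e.1 = a).card ≤ 2)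
    (hB : ∀ b, (F.filter fun e => e.2 = b).card ≤ 2) :
    ∃ M, IsMaximumMatching F M ∧ CoversDegreeTwo F M := by
  classical
  have hfst : ∀ b, ((F.image Prod.swap).filter fun e => e.1 = b).card =
      (F.filter fun e => e.2 = b).card := by
    intro b
    rw [Finset.filter_image, Finset.card_image_of_injective _ Prod.swap_injective]
    rfl
  have hsnd : ∀ a, ((F.image Prod.swap).filter fun e => e.2 = a).card =
      (F.filter fun e => e.1 = a).card := by
    intro a
    rw [Finset.filter_image, Finset.card_image_of_injective _ Prod.swap_injective]
    rfl
  obtain ⟨X, hX, hXA⟩ := exists_isMatching_of_card_filter_snd_le hB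
  obtain ⟨Y, hY, hYB⟩ := exists_isMatching_of_card_filter_snd_le (F := F.image Prod.swap)
    fun a => (hsnd a).trans_le (hA a)
  have hY' : IsMatching F (Y.image Prod.swap) := by
    have := hY.swap
    rwa [Finset.image_image, Prod.swap_swap_eq, Finset.image_id] at this
  obtain ⟨P, hP, hPmax⟩ := Finset.exists_max_image (F.powerset.filter fun M => IsMatching F M)
    Finset.card ⟨X, Finset.mem_filter.2 ⟨Finset.mem_powerset.2 hX.1, hX⟩⟩
  have hP' := (Finset.mem_filter.1 hP).2
  -- The men of `X` and the women of the maximum matching `P`, then the women of `Y` as well.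
  obtain ⟨Q, hQ, hXQ, hPQ⟩ := exists_isMatching_image_subset hX hP'
  obtain ⟨M, hM, hQM, hYM⟩ := exists_isMatching_image_subset hQ hY'
  have hPQ := Finset.card_le_card hPQ
  have hQM' := Finset.card_le_card hQM
  rw [hP'.card_image_snd, hQ.card_image_snd] at hPQ
  rw [hQ.card_image_fst, hM.card_image_fst] at hQM'
  refine ⟨M, ⟨hM, fun N hN => ?_⟩, fun a ha => ?_, fun b hb => ?_⟩
  · exact (hPmax N (Finset.mem_filter.2 ⟨Finset.mem_powerset.2 hN.1, hN⟩)).trans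
      (hPQ.trans hQM')
  · obtain ⟨e, he, rfl⟩ := Finset.mem_image.1 (hQM (hXQ (hXA a ha)))
    exact ⟨e.2, he⟩
  · obtain ⟨e, he, hb⟩ := Finset.mem_image.1 (hYB b ((hfst b).trans hb))
    obtain ⟨f, hf, h⟩ := Finset.mem_image.1 (hYM (Finset.mem_image.2
      ⟨e.swap, Finset.mem_image_of_mem _ he, rfl⟩))
    refine ⟨f.1, ?_⟩
    rw [← hb]
    have : f.2 = e.1 := h
    rw [← this]
    exact hf

/-- **König**: a maximum matching is at least as large as some vertex cover.  Otherwise Hall's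
condition would hold after `|A| - |M| - 1` women adjacent to all men have been added, and the
resulting matching, restricted to the original women, would be larger than `M`. -/
theorem IsMaximumMatching.exists_vertexCover [Fintype A] {F M : Finset (A × B)}
    (hM : IsMaximumMatching F M) :
    ∃ (C : Finset A) (D : Finset B), (∀ e ∈ F, e.1 ∈ C ∨ e.2 ∈ D) ∧
      C.card + D.card ≤ M.card := by
  classical
  by_cases hle : Fintype.card A ≤ M.card
  · exact ⟨Finset.univ, ∅, fun e _ => Or.inl (Finset.mem_univ _), by simpa using hle⟩
  obtain ⟨d, hd⟩ : ∃ d, Fintype.card A = M.card + 1 + d := ⟨Fintype.card A - M.card - 1, by omega⟩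
  let N : A → Finset B := fun a => (F.filter fun e => e.1 = a).image Prod.snd
  have hN : ∀ a b, b ∈ N a ↔ (a, b) ∈ F := by
    intro a b
    simp only [N, Finset.mem_image, Finset.mem_filter]
    constructor
    · rintro ⟨⟨x, y⟩, ⟨h, rfl⟩, rfl⟩
      exact h
    · exact fun h => ⟨_, ⟨h, rfl⟩, rfl⟩
  let t : A → Finset (B ⊕ Fin d) := fun a => (N a).disjSum Finset.univ
  by_cases hall : ∀ S : Finset A, S.card ≤ (S.biUnion t).card
  · exfalso
    obtain ⟨f, hinj, hf⟩ := (Finset.all_card_le_biUnion_card_iff_exists_injective t).1 hall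
    let P : Finset (A × B) := F.filter fun e => f e.1 = Sum.inl e.2
    have hP : IsMatching F P := by
      refine ⟨Finset.filter_subset _ _, ?_⟩
      intro e he e' he' h
      have h1 := (Finset.mem_filter.1 he).2
      have h2 := (Finset.mem_filter.1 he').2
      rcases h with h | h
      · rw [h, h2] at h1
        exact Prod.ext h (Sum.inl_injective h1).symm
      · rw [h, ← h2] at h1
        exact Prod.ext (hinj h1) h
    have hcount : (Finset.univ : Finset A).card ≤
        ((P.image fun e => (Sum.inl e.2 : B ⊕ Fin d)) ∪
          (Finset.univ : Finset (Fin d)).image Sum.inr).card := by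
      refine Finset.card_le_card_of_injOn f ?_ hinj.injOn
      intro a _
      have := hf a
      rw [Finset.mem_coe, Finset.mem_union, Finset.mem_image, Finset.mem_image]
      rcases h : f a with b | i
      · rw [h, Finset.inl_mem_disjSum] at this
        exact Or.inl ⟨(a, b), Finset.mem_filter.2 ⟨(hN a b).1 this, h⟩, rfl⟩
      · exact Or.inr ⟨i, Finset.mem_univ _, rfl⟩
    have h1 := hcount.trans (Finset.card_union_le _ _)
    have h2 := hM.2 P hP
    have h3 : (P.image fun e => (Sum.inl e.2 : B ⊕ Fin d)).card ≤ P.card :=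
      Finset.card_image_le
    have h4 : ((Finset.univ : Finset (Fin d)).image (Sum.inr : Fin d → B ⊕ Fin d)).card ≤ d :=
      Finset.card_image_le.trans (by simp)
    rw [Finset.card_univ] at h1
    omega
  · push Not at hall
    obtain ⟨S, hS⟩ := hall
    refine ⟨Sᶜ, S.biUnion N, ?_, ?_⟩
    · rintro ⟨a, b⟩ he
      by_cases ha : a ∈ S
      · exact Or.inr (Finset.mem_biUnion.2 ⟨a, ha, (hN a b).2 he⟩)
      · exact Or.inl (Finset.mem_compl.2 ha)
    · have hne : S.Nonempty := by
        rw [Finset.nonempty_iff_ne_empty]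
        rintro rfl
        simp at hS
      have hunion : (S.biUnion N).disjSum (Finset.univ : Finset (Fin d)) ⊆ S.biUnion t := by
        intro x hx
        rw [Finset.mem_biUnion]
        rcases x with b | i
        · rw [Finset.inl_mem_disjSum, Finset.mem_biUnion] at hx
          obtain ⟨a, ha, hb⟩ := hx
          exact ⟨a, ha, Finset.inl_mem_disjSum.2 hb⟩
        · obtain ⟨a, ha⟩ := hne
          exact ⟨a, ha, Finset.inr_mem_disjSum.2 (Finset.mem_univ _)⟩
      have h1 := Finset.card_le_card hunion
      rw [Finset.card_disjSum, Finset.card_univ, Fintype.card_fin] at h1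
      have h2 := Finset.card_le_univ S
      rw [Finset.card_compl]
      omega

end Matching

/-! ### The proposal phase -/

section ProposalPhase

section Holds

variable {A B : Type*} [DecidableEq B] {I : Market A B} {s : State A B}

theorem State.mem_holds {b : B} {p : A × Fin 2} :
    p ∈ s.holds I b ↔ p ∈ s.held ∧ (I.menList p.1)[s.pos p]? = some b := by
  simp [State.holds]

theorem State.eq_of_mem_holds {p : A × Fin 2} {b c : B} (hb : p ∈ s.holds I b)
    (hc : p ∈ s.holds I c) : b = c :=
  Option.some_injective _
    ((State.mem_holds.1 hb).2.symm.trans (State.mem_holds.1 hc).2)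

theorem State.mem_menList_of_mem_holds {p : A × Fin 2} {b : B} (hb : p ∈ s.holds I b) :
    b ∈ I.menList p.1 :=
  List.mem_of_getElem? (State.mem_holds.1 hb).2

theorem State.idxOf_eq_pos_of_mem_holds {p : A × Fin 2} {b : B} (hb : p ∈ s.holds I b) :
    (I.menList p.1).idxOf b = s.pos p := by
  obtain ⟨h, rfl⟩ := List.getElem?_eq_some_iff.1 (State.mem_holds.1 hb).2
  exact (I.nodup p.1).idxOf_getElem _ h

end Holds

variable {A B : Type*} [Fintype B] [DecidableEq A] [DecidableEq B]
variable {I : Market A B} {s t : State A B}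

/-- The number of promotions behind a status. -/
def Status.num : Status → ℕ
  | .basic => 0
  | .onePromoted => 1
  | .twoPromoted => 2

theorem Status.num_injective : Function.Injective Status.num := by
  intro σ τ h
  cases σ <;> cases τ <;> simp_all [Status.num]

theorem Status.num_le_two (σ : Status) : σ.num ≤ 2 := by
  cases σ <;> simp [Status.num]

open Classical in
/-- How the woman `b` ranks the man `a` inside a tie class, smaller being better: `2`-promoted men,
`1`-promoted men, basic men whom she has rejected, other basic men. -/
noncomputable def State.level (I : Market A B) (s : State A B) (b : B) (a : A) : ℕ :=
  match s.status I a with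
  | .twoPromoted => 0
  | .onePromoted => 1
  | .basic => if ∃ σ, (a, b, σ) ∈ s.rejections then 2 else 3

/-- How the woman `b` ranks the proposals of the man `a`, smaller being better: first her
preferences, then the level inside a tie class. -/
noncomputable def State.key (I : Market A B) (s : State A B) (b : B) (a : A) : ℕ :=
  4 * I.rank b a + s.level I b a

/-- The woman `b` holds at least two proposals, and none of them is worse than `K`. -/
def State.Bounded (I : Market A B) (s : State A B) (b : B) (K : ℕ) : Prop :=
  2 ≤ (s.holds I b).card ∧ ∀ p ∈ s.holds I b, s.key I b p.1 ≤ K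

theorem State.level_le_three (a : A) (b : B) : s.level I b a ≤ 3 := by
  unfold State.level
  split
  · omega
  · omega
  · split <;> omega

/-- The worst level inside a tie class that a man of status `σ` may have. -/
def Status.maxLevel : Status → ℕ
  | .basic => 3
  | .onePromoted => 1
  | .twoPromoted => 0

theorem State.key_le_maxLevel (a : A) (b : B) :
    s.key I b a ≤ 4 * I.rank b a + (s.status I a).maxLevel := by
  unfold State.key State.level Status.maxLevel
  split <;> simp_all
  split <;> omega

theorem State.superior_iff_key_lt {b : B} {a a' : A} :
    s.superior I b a a' ↔ s.key I b a < s.key I b a' := by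
  have h1 := s.level_le_three (I := I) a b
  have h2 := s.level_le_three (I := I) a' b
  unfold State.superior State.key Market.womanPrefers Market.indifferent
  rcases lt_trichotomy (I.rank b a) (I.rank b a') with h | h | h
  · simp only [h, true_or, true_iff]
    omega
  · rw [h]
    simp only [lt_irrefl, true_and, false_or, add_lt_add_iff_left]
    unfold State.level
    rcases hs : s.status I a <;> rcases hs' : s.status I a' <;> simp
    all_goals split_ifs <;> simp_all
  · have hne : I.rank b a ≠ I.rank b a' := by omega
    simp only [hne, not_lt_of_gt h, false_and, false_or, false_iff]
    omega

theorem State.Bounded.mono {b : B} {K L : ℕ} (h : s.Bounded I b K) (hKL : K ≤ L) :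
    s.Bounded I b L :=
  ⟨h.1, fun p hp => (h.2 p hp).trans hKL⟩

theorem State.num_status_le_of_subset (h : s.rejections ⊆ t.rejections) (a : A) :
    (s.status I a).num ≤ (t.status I a).num := by
  have hmono : ∀ σ, s.rejectedByAll I a σ → t.rejectedByAll I a σ :=
    fun σ hs b hb => h (hs b hb)
  have h0 := hmono .basic
  have h1 := hmono .onePromoted
  unfold State.status
  split_ifs <;> simp_all [Status.num]

theorem State.level_le_of_subset (h : s.rejections ⊆ t.rejections) (a : A) (b : B) :
    t.level I b a ≤ s.level I b a := by
  have h0 := State.num_status_le_of_subset (I := I) h a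
  have h1 : (∃ σ, (a, b, σ) ∈ s.rejections) → ∃ σ, (a, b, σ) ∈ t.rejections :=
    fun ⟨σ, hσ⟩ => ⟨σ, h hσ⟩
  unfold State.level
  revert h0
  rcases s.status I a <;> rcases t.status I a <;> simp [Status.num]
  all_goals split_ifs <;> simp_all

theorem State.key_le_of_subset (h : s.rejections ⊆ t.rejections) (a : A) (b : B) :
    t.key I b a ≤ s.key I b a :=
  Nat.add_le_add_left (State.level_le_of_subset h a b) _

theorem State.key_le_of_mem_rejections {a : A} {b : B} {σ : Status}
    (h : (a, b, σ) ∈ s.rejections) : s.key I b a ≤ 4 * I.rank b a + 2 := by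
  have : s.level I b a ≤ 2 := by
    unfold State.level
    split
    · omega
    · omega
    · rw [if_pos ⟨σ, h⟩]
  unfold State.key
  omega

theorem State.stopped_of_rejectedByAll_status {a : A}
    (h : s.rejectedByAll I a (s.status I a)) : s.stopped I a := by
  have h2 : s.status I a = .twoPromoted := by
    revert h
    unfold State.status
    split_ifs <;> simp_all
  exact ⟨h2, h2 ▸ h⟩

theorem State.rejected_of_status_ne_basic {a : A} {b : B} (hb : b ∈ I.menList a)
    (hs : s.status I a ≠ .basic) : (a, b, .basic) ∈ s.rejections := by
  by_contra hrej
  refine hs ?_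
  unfold State.status
  rw [if_neg fun h => hrej (h b hb)]

theorem State.holds_accept {p : A × Fin 2} {b : B} (hp : s.canPropose I p b) (c : B) :
    (s.accept p).holds I c = if c = b then insert p (s.holds I c) else s.holds I c := by
  ext q
  split_ifs with h
  · subst h
    simp only [State.mem_holds, State.accept, Finset.mem_insert]
    constructor
    · rintro ⟨rfl | h, h'⟩
      · exact Or.inl rfl
      · exact Or.inr ⟨h, h'⟩
    · rintro (rfl | h)
      · exact ⟨Or.inl rfl, hp.2.2⟩
      · exact ⟨Or.inr h.1, h.2⟩
  · simp only [State.mem_holds, State.accept, Finset.mem_insert]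
    constructor
    · rintro ⟨rfl | h1, h'⟩
      · rw [hp.2.2] at h'
        exact (h (Option.some_injective _ h').symm).elim
      · exact ⟨h1, h'⟩
    · exact fun h => ⟨Or.inr h.1, h.2⟩

theorem State.address_of_mem_insert {p q : A × Fin 2} {b : B} (hp : s.canPropose I p b)
    (hq : q ∈ insert p (s.holds I b)) : (I.menList q.1)[s.pos q]? = some b := by
  rcases Finset.mem_insert.1 hq with rfl | hq
  · exact hp.2.2
  · exact (State.mem_holds.1 hq).2

theorem State.holds_reject {p q : A × Fin 2} {b : B} (hp : s.canPropose I p b)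
    (hq : q ∈ insert p (s.holds I b)) (c : B) :
    (s.reject I p b q).holds I c =
      if c = b then (insert p (s.holds I c)).erase q else s.holds I c := by
  have hqb := State.address_of_mem_insert hp hq
  ext x
  by_cases hx : x = q
  · subst hx
    split_ifs with h
    · simp [State.mem_holds, State.reject]
    · simp only [State.mem_holds, State.reject, Finset.mem_erase, ne_eq, not_true_eq_false,
        false_and, false_iff]
      rintro ⟨-, h'⟩
      rw [hqb] at h'
      exact h (Option.some_injective _ h').symm
  · have hpos : (s.reject I p b q).pos x = s.pos x := Function.update_of_ne hx _ _
    have hheld : x ∈ (s.reject I p b q).held ↔ x = p ∨ x ∈ s.held := by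
      simp [State.reject, hx]
    rw [State.mem_holds, hpos, hheld]
    split_ifs with h
    · subst h
      rw [Finset.mem_erase, Finset.mem_insert, State.mem_holds]
      constructor
      · rintro ⟨rfl | h, h'⟩
        · exact ⟨hx, Or.inl rfl⟩
        · exact ⟨hx, Or.inr ⟨h, h'⟩⟩
      · rintro ⟨-, rfl | h⟩
        · exact ⟨Or.inl rfl, hp.2.2⟩
        · exact ⟨Or.inr h.1, h.2⟩
    · rw [State.mem_holds]
      constructor
      · rintro ⟨rfl | h1, h'⟩
        · rw [hp.2.2] at h'
          exact (h (Option.some_injective _ h').symm).elim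
        · exact ⟨h1, h'⟩
      · exact fun h => ⟨Or.inr h.1, h.2⟩

theorem State.card_erase_insert_holds {p q : A × Fin 2} {b : B} (hp : s.canPropose I p b)
    (hq : q ∈ insert p (s.holds I b)) :
    ((insert p (s.holds I b)).erase q).card = (s.holds I b).card := by
  rw [Finset.card_erase_of_mem hq, Finset.card_insert_of_notMem
    fun h => hp.1 (State.mem_holds.1 h).1, Nat.add_sub_cancel]

theorem State.rejections_subset_reject (p : A × Fin 2) (b : B) (q : A × Fin 2) :
    s.rejections ⊆ (s.reject I p b q).rejections :=
  Finset.subset_insert _ _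

/-- After a rejection the woman holds nothing worse than what she has rejected. -/
theorem State.bounded_reject {p q : A × Fin 2} {b : B} (hp : s.canPropose I p b)
    (hb : 2 ≤ (s.holds I b).card) (hq : s.leastDesirable I b (insert p (s.holds I b)) q) :
    (s.reject I p b q).Bounded I b (s.key I b q.1) := by
  have hholds := State.holds_reject hp hq.1 b
  rw [if_pos rfl] at hholds
  refine ⟨?_, fun x hx => ?_⟩
  · rwa [hholds, State.card_erase_insert_holds hp hq.1]
  · rw [hholds] at hx
    refine (State.key_le_of_subset (State.rejections_subset_reject p b q) _ _).trans ?_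
    have := hq.2 x (Finset.mem_of_mem_erase hx)
    rwa [State.superior_iff_key_lt, not_lt] at this

/-- What a woman holds never gets worse, because she rejects a worst proposal and because the
levels of the men only improve. -/
theorem State.Bounded.step {b : B} {K : ℕ} (h : s.Bounded I b K) (hst : Step I s t) :
    t.Bounded I b K := by
  cases hst with
  | @accept p c hp hc =>
    have hcb : b ≠ c := by
      rintro rfl
      exact absurd h.1 (by omega)
    have hholds := State.holds_accept hp b
    rw [if_neg hcb] at hholds
    unfold State.Bounded
    rw [hholds]
    exact h
  | @reject p c q hp hc hq =>
    have hsub := State.rejections_subset_reject (I := I) (s := s) p c q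
    by_cases hcb : b = c
    · subst hcb
      by_cases hqp : q = p
      · have hholds := State.holds_reject hp hq.1 b
        rw [if_pos rfl, hqp, Finset.erase_insert fun h => hp.1 (State.mem_holds.1 h).1] at hholds
        unfold State.Bounded
        subst hqp
        rw [hholds]
        exact ⟨h.1, fun x hx => (State.key_le_of_subset hsub _ _).trans (h.2 x hx)⟩
      · have hqK : s.key I b q.1 ≤ K := h.2 q (Finset.mem_of_mem_insert_of_ne hq.1 hqp)
        exact (State.bounded_reject hp hc hq).mono hqK
    · have hholds := State.holds_reject hp hq.1 b
      rw [if_neg hcb] at hholds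
      unfold State.Bounded
      rw [hholds]
      exact ⟨h.1, fun x hx => (State.key_le_of_subset hsub _ _).trans (h.2 x hx)⟩

/-- A proposal phase that has not ended can be continued: among finitely many proposals there is
always one of largest key. -/
theorem State.exists_step (hs : ¬ s.finished I)
    (hpos : ∀ p : A × Fin 2, I.menList p.1 ≠ [] → s.pos p < (I.menList p.1).length) :
    ∃ t, Step I s t := by
  unfold State.finished at hs
  push Not at hs
  obtain ⟨p, hp, hproposes⟩ := hs
  have hne : I.menList p.1 ≠ [] := by
    intro h
    refine hproposes (State.stopped_of_rejectedByAll_status ?_)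
    intro b hb
    simp [h] at hb
  obtain ⟨b, hb⟩ : ∃ b, (I.menList p.1)[s.pos p]? = some b :=
    ⟨_, List.getElem?_eq_getElem (hpos p hne)⟩
  have hcan : s.canPropose I p b := ⟨hp, hproposes, hb⟩
  rcases Nat.lt_or_ge 1 (s.holds I b).card with h | h
  · obtain ⟨q, hq, hmax⟩ := Finset.exists_max_image (insert p (s.holds I b))
      (fun q => s.key I b q.1) ⟨p, Finset.mem_insert_self _ _⟩
    refine ⟨_, Step.reject hcan h ⟨hq, fun r hr => ?_⟩⟩
    rw [State.superior_iff_key_lt, not_lt]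
    exact hmax r hr
  · exact ⟨_, Step.accept hcan h⟩

end ProposalPhase

/-! ### Invariants of the proposal phase -/

section Invariants

variable {A B : Type*} [Fintype A] [Fintype B] [DecidableEq A] [DecidableEq B]
variable {I : Market A B} {n : ℕ} {s t : State A B} {r : A × Fin 2 → ℕ}

/-- The invariants of a state that is reached with `n` proposals, where `r p` is the number of
rejections of the proposal `p` so far.  The rejection of `p` with index `x < r p` came from the
woman at index `x % length` of the list, in round `x / length` of `p`. -/
structure State.Invariant (I : Market A B) (n : ℕ) (s : State A B) (r : A × Fin 2 → ℕ) :
    Prop where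
  pos_eq : ∀ p, s.pos p = r p % (I.menList p.1).length
  count : n = s.held.card + ∑ p, r p
  le : ∀ p, r p ≤ 3 * (I.menList p.1).length
  lt_of_held : ∀ p ∈ s.held, r p < 3 * (I.menList p.1).length
  /-- In round `k` of one of his proposals, a man has been promoted at least `k` times. -/
  recorded : ∀ p x, x < r p → ∃ b σ, (I.menList p.1)[x % (I.menList p.1).length]? = some b ∧
    (p.1, b, σ) ∈ s.rejections ∧ x / (I.menList p.1).length ≤ σ.num
  num_le : ∀ a b σ, (a, b, σ) ∈ s.rejections → σ.num ≤ (s.status I a).num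
  exists_index : ∀ a b σ, (a, b, σ) ∈ s.rejections → ∃ i x, x < r (a, i) ∧
    (I.menList a)[x % (I.menList a).length]? = some b
  bounded : ∀ a b σ, (a, b, σ) ∈ s.rejections → s.Bounded I b (4 * I.rank b a + σ.maxLevel)
  /-- A second rejection by the same woman happens at a better level than a first one. -/
  bounded_of_twice : ∀ a i j x y b, (i, x) ≠ (j, y) → x < r (a, i) → y < r (a, j) →
    (I.menList a)[x % (I.menList a).length]? = some b →
    (I.menList a)[y % (I.menList a).length]? = some b → s.Bounded I b (4 * I.rank b a + 2)
  card_holds_le : ∀ b, (s.holds I b).card ≤ 2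

theorem State.Invariant.lt_of_not_stopped (h : s.Invariant I n r) {a : A} {i : Fin 2}
    (hs : ¬ s.stopped I a) : r (a, i) < (I.menList a).length * ((s.status I a).num + 1) := by
  by_contra hlt
  refine hs (State.stopped_of_rejectedByAll_status fun b hb => ?_)
  obtain ⟨j, hj, rfl⟩ := List.mem_iff_getElem.1 hb
  have hx : (I.menList a).length * (s.status I a).num + j < r (a, i) := by
    rw [Nat.mul_add] at hlt
    omega
  obtain ⟨b, σ, hb, hσ, hle⟩ := h.recorded (a, i) _ hx
  rw [Nat.mul_add_mod, Nat.mod_eq_of_lt hj, List.getElem?_eq_getElem hj] at hb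
  rw [Nat.mul_add_div (by omega), Nat.div_eq_of_lt hj] at hle
  have : σ = s.status I a := Status.num_injective (le_antisymm (h.num_le _ _ _ hσ) hle)
  rw [Option.some_injective _ hb, ← this]
  exact hσ

theorem State.Invariant.lt_of_not_stopped' (h : s.Invariant I n r) {a : A} {i : Fin 2}
    (hs : ¬ s.stopped I a) : r (a, i) < 3 * (I.menList a).length := by
  refine (h.lt_of_not_stopped hs).trans_le ?_
  rw [mul_comm]
  exact Nat.mul_le_mul_right _ (Nat.succ_le_succ (Status.num_le_two _))

theorem State.Invariant.pos_lt (h : s.Invariant I n r) (p : A × Fin 2)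
    (hp : I.menList p.1 ≠ []) : s.pos p < (I.menList p.1).length := by
  rw [h.pos_eq]
  exact Nat.mod_lt _ (List.length_pos_iff.2 hp)

theorem State.Invariant.accept (h : s.Invariant I n r) {p : A × Fin 2} {b : B}
    (hp : s.canPropose I p b) (hb : (s.holds I b).card ≤ 1) :
    (s.accept p).Invariant I (n + 1) r where
  pos_eq := h.pos_eq
  count := by
    have : (s.accept p).held.card = s.held.card + 1 := Finset.card_insert_of_notMem hp.1
    rw [this, h.count]
    omega
  le := h.le
  lt_of_held q hq := by
    rcases Finset.mem_insert.1 hq with rfl | hq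
    · exact h.lt_of_not_stopped' hp.2.1
    · exact h.lt_of_held q hq
  recorded := h.recorded
  num_le := h.num_le
  exists_index := h.exists_index
  bounded a c σ hσ := (h.bounded a c σ hσ).step (Step.accept hp hb)
  bounded_of_twice a i j x y c hne hx hy hxc hyc :=
    (h.bounded_of_twice a i j x y c hne hx hy hxc hyc).step (Step.accept hp hb)
  card_holds_le c := by
    rw [State.holds_accept hp]
    split_ifs with hc
    · subst hc
      exact (Finset.card_insert_le _ _).trans (by omega)
    · exact h.card_holds_le c

theorem State.Invariant.reject (h : s.Invariant I n r) {p q : A × Fin 2} {b : B}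
    (hp : s.canPropose I p b) (hb : 2 ≤ (s.holds I b).card)
    (hq : s.leastDesirable I b (insert p (s.holds I b)) q) :
    (s.reject I p b q).Invariant I (n + 1) (Function.update r q (r q + 1)) := by
  have hst : Step I s (s.reject I p b q) := Step.reject hp hb hq
  have hsub := State.rejections_subset_reject (I := I) (s := s) p b q
  have hqb := State.address_of_mem_insert hp hq.1
  have hq3 : r q < 3 * (I.menList q.1).length := by
    rcases Finset.mem_insert.1 hq.1 with rfl | hq
    · exact h.lt_of_not_stopped' hp.2.1
    · exact h.lt_of_held q (State.mem_holds.1 hq).1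
  have hqdiv : r q / (I.menList q.1).length ≤ (s.status I q.1).num := by
    rw [← Nat.lt_succ_iff, Nat.div_lt_iff_lt_mul (by omega), mul_comm]
    by_cases hs : s.stopped I q.1
    · rw [hs.1, mul_comm]
      exact hq3
    · exact h.lt_of_not_stopped (i := q.2) hs
  have hbound := State.bounded_reject hp hb hq
  rw [h.pos_eq q] at hqb
  have hmem : ∀ a c σ, (a, c, σ) ∈ (s.reject I p b q).rejections ↔
      (a = q.1 ∧ c = b ∧ σ = s.status I q.1) ∨ (a, c, σ) ∈ s.rejections := by
    intro a c σ
    simp [State.reject]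
  -- The rejections of the proposals before and after the step.
  have hr : ∀ p' x, x < Function.update r q (r q + 1) p' ↔ x < r p' ∨ (p' = q ∧ x = r q) := by
    intro p' x
    by_cases hpq : p' = q
    · subst hpq
      simp only [Function.update_self, true_and]
      omega
    · simp [hpq]
  refine ⟨?_, ?_, ?_, ?_, ?_, ?_, ?_, ?_, ?_, ?_⟩
  · intro p'
    by_cases hpq : p' = q
    · subst hpq
      simp only [State.reject, Function.update_self]
      rw [h.pos_eq, Nat.mod_add_mod]
    · simp only [State.reject, Function.update_of_ne hpq]
      exact h.pos_eq p'
  · have hcard : (s.reject I p b q).held.card = s.held.card := by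
      have hq' : q ∈ insert p s.held := by
        refine Finset.insert_subset_insert p ?_ hq.1
        exact fun x hx => (State.mem_holds.1 hx).1
      simp only [State.reject]
      rw [Finset.card_erase_of_mem hq', Finset.card_insert_of_notMem hp.1, Nat.add_sub_cancel]
    have hsum : ∑ p', Function.update r q (r q + 1) p' = ∑ p', r p' + 1 := by
      rw [Finset.sum_update_of_mem (Finset.mem_univ q),
        ← Finset.add_sum_erase _ r (Finset.mem_univ q), Finset.sdiff_singleton_eq_erase]
      omega
    rw [hcard, hsum, h.count]
    omega
  · intro p'
    by_cases hpq : p' = q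
    · subst hpq
      rw [Function.update_self]
      omega
    · rw [Function.update_of_ne hpq]
      exact h.le p'
  · intro p' hp'
    simp only [State.reject, Finset.mem_erase, Finset.mem_insert] at hp'
    rw [Function.update_of_ne hp'.1]
    rcases hp'.2 with rfl | hp'
    · exact h.lt_of_not_stopped' hp.2.1
    · exact h.lt_of_held p' hp'
  · intro p' x hx
    rcases (hr p' x).1 hx with hx | ⟨rfl, rfl⟩
    · obtain ⟨c, σ, hc, hσ, hle⟩ := h.recorded p' x hx
      exact ⟨c, σ, hc, hsub hσ, hle⟩
    · exact ⟨b, _, hqb, (hmem _ _ _).2 (Or.inl ⟨rfl, rfl, rfl⟩), hqdiv⟩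
  · intro a c σ hσ
    refine le_trans ?_ (State.num_status_le_of_subset (I := I) hsub a)
    rcases (hmem a c σ).1 hσ with ⟨rfl, rfl, rfl⟩ | hσ
    · exact le_rfl
    · exact h.num_le a c σ hσ
  · intro a c σ hσ
    rcases (hmem a c σ).1 hσ with ⟨rfl, rfl, rfl⟩ | hσ
    · exact ⟨q.2, r q, (hr _ _).2 (Or.inr ⟨rfl, rfl⟩), hqb⟩
    · obtain ⟨i, x, hx, hc⟩ := h.exists_index a c σ hσ
      exact ⟨i, x, (hr _ _).2 (Or.inl hx), hc⟩
  · intro a c σ hσ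
    rcases (hmem a c σ).1 hσ with ⟨rfl, rfl, rfl⟩ | hσ
    · exact hbound.mono (State.key_le_maxLevel _ _)
    · exact (h.bounded a c σ hσ).step hst
  · -- A new rejection of `a` that follows an earlier one by the same woman.
    have hnew : ∀ p' y c, p'.1 = q.1 → y < r p' →
        (I.menList q.1)[r q % (I.menList q.1).length]? = some c →
        (I.menList q.1)[y % (I.menList q.1).length]? = some c →
        (s.reject I p b q).Bounded I c (4 * I.rank c q.1 + 2) := by
      intro p' y c hpq hy hc hyc
      rw [hqb] at hc
      obtain rfl := Option.some_injective _ hc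
      obtain ⟨c', σ, hc', hσ, -⟩ := h.recorded p' y hy
      rw [hpq] at hc' hσ
      rw [hyc] at hc'
      obtain rfl := Option.some_injective _ hc'
      exact hbound.mono (State.key_le_of_mem_rejections hσ)
    intro a i j x y c hne hx hy hxc hyc
    rcases (hr _ _).1 hx with hx | ⟨hiq, rfl⟩ <;> rcases (hr _ _).1 hy with hy | ⟨hjq, rfl⟩
    · exact (h.bounded_of_twice a i j x y c hne hx hy hxc hyc).step hst
    · have ha : a = q.1 := congrArg Prod.fst hjq
      subst ha
      exact hnew (q.1, i) x c rfl hx hyc hxc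
    · have ha : a = q.1 := congrArg Prod.fst hiq
      subst ha
      exact hnew (q.1, j) y c rfl hy hxc hyc
    · exact absurd (by rw [Prod.ext_iff] at hiq hjq; simp_all) hne
  · intro c
    rw [State.holds_reject hp hq.1]
    split_ifs with hc
    · subst hc
      rw [State.card_erase_insert_holds hp hq.1]
      exact h.card_holds_le c
    · exact h.card_holds_le c

theorem State.invariant_initial : State.Invariant I 0 State.initial fun _ => 0 := by
  have hholds : ∀ b, (State.initial : State A B).holds I b = ∅ := fun b => Finset.filter_empty _
  refine ⟨?_, ?_, ?_, ?_, ?_, ?_, ?_, ?_, ?_, fun b => by simp [hholds]⟩ <;>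
    simp [State.initial]

theorem Run.exists_invariant (h : Run I n s) : ∃ r, s.Invariant I n r := by
  induction h with
  | zero => exact ⟨_, State.invariant_initial⟩
  | succ _ hst ih =>
    obtain ⟨r, hr⟩ := ih
    cases hst with
    | accept hp hb => exact ⟨r, hr.accept hp hb⟩
    | reject hp hb hq => exact ⟨_, hr.reject hp hb hq⟩

theorem Market.card_edges (hI : ∀ a, (I.menList a).Nodup) :
    I.edges.card = ∑ a, (I.menList a).length := by
  have : I.edges.card = ∑ a, (I.edges.filter fun e => e.1 = a).card :=
    Finset.card_eq_sum_card_fiberwise fun _ _ => Finset.mem_coe.2 (Finset.mem_univ _)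
  rw [this]
  refine Finset.sum_congr rfl fun a _ => ?_
  rw [← List.toFinset_card_of_nodup (hI a)]
  refine Finset.card_bij (fun e _ => e.2) ?_ ?_ ?_
  · intro e he
    simp only [Market.edges, Finset.mem_filter, Finset.mem_univ, true_and] at he
    rw [List.mem_toFinset, ← he.2]
    exact he.1
  · intro e he f hf h
    exact Prod.ext ((Finset.mem_filter.1 he).2.trans (Finset.mem_filter.1 hf).2.symm) h
  · intro b hb
    exact ⟨(a, b), by simpa [Market.edges] using hb, rfl⟩

/-- A proposal has been rejected at most `3 * length` times, and less often if it is held, so that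
it has been made at most `3 * length` times in either case. -/
theorem State.Invariant.le_six_mul_card_edges (h : s.Invariant I n r) :
    n ≤ 6 * I.edges.card := by
  have hsum : n = ∑ p, ((if p ∈ s.held then 1 else 0) + r p) := by
    rw [Finset.sum_add_distrib, h.count]
    simp
  rw [hsum, Market.card_edges I.nodup]
  calc ∑ p : A × Fin 2, ((if p ∈ s.held then 1 else 0) + r p)
      ≤ ∑ p : A × Fin 2, 3 * (I.menList p.1).length := by
        refine Finset.sum_le_sum fun p _ => ?_
        split_ifs with hp
        · have := h.lt_of_held p hp
          omega
        · have := h.le p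
          omega
    _ = 6 * ∑ a, (I.menList a).length := by
        rw [Fintype.sum_prod_type, Finset.mul_sum]
        refine Finset.sum_congr rfl fun a _ => ?_
        rw [Fin.sum_univ_two]
        dsimp only
        omega

end Invariants

/-! ### The graph of the held proposals -/

section Output

theorem Market.mem_edges {A B : Type*} [Fintype A] [Fintype B] [DecidableEq B] {I : Market A B}
    {a : A} {b : B} : (a, b) ∈ I.edges ↔ b ∈ I.menList a := by
  simp [Market.edges]

variable {A B : Type*} [Fintype A] [Fintype B] [DecidableEq A] [DecidableEq B]
variable {I : Market A B} {n : ℕ} {s : State A B} {r : A × Fin 2 → ℕ} {M : Finset (A × B)}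

theorem State.mem_accepted {a : A} {b : B} :
    (a, b) ∈ s.accepted I ↔ ∃ i, (a, i) ∈ s.holds I b := by
  simp [State.accepted]

theorem State.accepted_subset_edges : s.accepted I ⊆ I.edges := by
  rintro ⟨a, b⟩ h
  obtain ⟨i, hi⟩ := State.mem_accepted.1 h
  exact Market.mem_edges.2 (State.mem_menList_of_mem_holds hi)

theorem State.card_accepted_fst_le (a : A) :
    ((s.accepted I).filter fun e => e.1 = a).card ≤ 2 := by
  classical
  have : ∀ e ∈ (s.accepted I).filter fun e => e.1 = a, ∃ i : Fin 2, (a, i) ∈ s.holds I e.2 := by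
    rintro ⟨x, b⟩ he
    obtain ⟨h, rfl⟩ := Finset.mem_filter.1 he
    exact State.mem_accepted.1 h
  choose! f hf using this
  refine (Finset.card_le_card_of_injOn (t := (Finset.univ : Finset (Fin 2))) f
    (fun _ _ => Finset.mem_coe.2 (Finset.mem_univ _)) ?_).trans (by simp)
  intro e he e' he' h
  have h1 := hf e he
  rw [h] at h1
  exact Prod.ext ((Finset.mem_filter.1 he).2.trans (Finset.mem_filter.1 he').2.symm)
    (State.eq_of_mem_holds h1 (hf e' he'))

theorem State.Invariant.card_accepted_snd_le (h : s.Invariant I n r) (b : B) :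
    ((s.accepted I).filter fun e => e.2 = b).card ≤ 2 := by
  refine le_trans ?_ (h.card_holds_le b)
  refine (Finset.card_le_card (t := (s.holds I b).image fun p => (p.1, b)) ?_).trans
    Finset.card_image_le
  rintro ⟨a, c⟩ he
  obtain ⟨hac, rfl⟩ := Finset.mem_filter.1 he
  obtain ⟨i, hi⟩ := State.mem_accepted.1 hac
  exact Finset.mem_image.2 ⟨_, hi, rfl⟩

theorem State.Invariant.exists_mem_holds (h : s.Invariant I n r) {p : A × Fin 2}
    (hp : p ∈ s.held) : ∃ b, p ∈ s.holds I b := by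
  have hlt := h.lt_of_held p hp
  have hne : I.menList p.1 ≠ [] := by
    intro h0
    simp [h0] at hlt
  exact ⟨_, State.mem_holds.2 ⟨hp, List.getElem?_eq_getElem (h.pos_lt p hne)⟩⟩

/-- A man with two held proposals is matched: either he has degree two, or both proposals are held
by the same woman, and the two of them form a component. -/
theorem State.IsOutput.exists_mem_of_man (hM : s.IsOutput I M) (h : s.Invariant I n r) {a : A}
    {b c : B} (hb : (a, 0) ∈ s.holds I b) (hc : (a, 1) ∈ s.holds I c) : ∃ d, (a, d) ∈ M := by
  by_cases hbc : b = c
  · subst hbc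
    by_contra hno
    push Not at hno
    have hholds : s.holds I b = {(a, 0), (a, 1)} := by
      refine (Finset.eq_of_subset_of_card_le ?_ ?_).symm
      · exact Finset.insert_subset hb (Finset.singleton_subset_iff.2 hc)
      · rw [Finset.card_pair (by simp)]
        exact h.card_holds_le b
    have hmatch := IsMatching.insert_of_forall_ne hM.1.1
      (State.mem_accepted.2 ⟨0, hb⟩) (by
        rintro ⟨x, y⟩ hf rfl
        exact hno _ hf) (by
        rintro ⟨x, y⟩ hf rfl
        obtain ⟨i, hi⟩ := State.mem_accepted.1 (hM.1.1.1 hf)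
        rw [hholds] at hi
        have hx : x = a := by
          simp only [Finset.mem_insert, Finset.mem_singleton, Prod.mk.injEq] at hi
          exact hi.elim And.left And.left
        exact hno _ (hx ▸ hf))
    have := hM.1.2 _ hmatch
    rw [Finset.card_insert_of_notMem (hno b)] at this
    omega
  · refine hM.2.1 a (le_antisymm (State.card_accepted_fst_le a) ?_)
    have hcard : ({(a, b), (a, c)} : Finset (A × B)).card = 2 := Finset.card_pair (by simpa)
    rw [← hcard]
    refine Finset.card_le_card (Finset.insert_subset ?_ (Finset.singleton_subset_iff.2 ?_))
    · exact Finset.mem_filter.2 ⟨State.mem_accepted.2 ⟨_, hb⟩, rfl⟩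
    · exact Finset.mem_filter.2 ⟨State.mem_accepted.2 ⟨_, hc⟩, rfl⟩

theorem State.IsOutput.exists_mem_of_woman (hM : s.IsOutput I M) (h : s.Invariant I n r) {b : B}
    (hb : 2 ≤ (s.holds I b).card) : ∃ a, (a, b) ∈ M := by
  obtain ⟨p, hp, q, hq, hpq⟩ := Finset.one_lt_card.1 hb
  by_cases hfst : p.1 = q.1
  · obtain ⟨a, i⟩ := p
    obtain ⟨a', j⟩ := q
    obtain rfl : a = a' := hfst
    have hij : i ≠ j := fun hij => hpq (by rw [hij])
    have hall : ∀ k, (a, k) ∈ s.holds I b := by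
      intro k
      obtain rfl | rfl : k = i ∨ k = j := by omega
      · exact hp
      · exact hq
    obtain ⟨d, hd⟩ := hM.exists_mem_of_man h (hall 0) (hall 1)
    obtain ⟨k, hk⟩ := State.mem_accepted.1 (hM.1.1.1 hd)
    exact ⟨a, State.eq_of_mem_holds hk (hall k) ▸ hd⟩
  · refine hM.2.2 b (le_antisymm (h.card_accepted_snd_le b) ?_)
    have hcard : ({(p.1, b), (q.1, b)} : Finset (A × B)).card = 2 := Finset.card_pair (by simpa)
    rw [← hcard]
    refine Finset.card_le_card (Finset.insert_subset ?_ (Finset.singleton_subset_iff.2 ?_))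
    · exact Finset.mem_filter.2 ⟨State.mem_accepted.2 ⟨_, hp⟩, rfl⟩
    · exact Finset.mem_filter.2 ⟨State.mem_accepted.2 ⟨_, hq⟩, rfl⟩

theorem State.Invariant.exists_isOutput (h : s.Invariant I n r) : ∃ M, s.IsOutput I M :=
  exists_isMaximumMatching_coversDegreeTwo State.card_accepted_fst_le h.card_accepted_snd_le

theorem State.Invariant.rejections_le_idxOf (h : s.Invariant I n r) {a : A} {b : B}
    (hb : b ∈ I.menList a) (hrej : ¬ ∃ σ, (a, b, σ) ∈ s.rejections) (i : Fin 2) :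
    r (a, i) ≤ (I.menList a).idxOf b := by
  by_contra hlt
  obtain ⟨c, σ, hc, hσ, -⟩ := h.recorded (a, i) _ (not_le.1 hlt)
  rw [Nat.mod_eq_of_lt (List.idxOf_lt_length_of_mem hb), List.getElem?_idxOf hb] at hc
  obtain rfl := Option.some_injective _ hc
  exact hrej ⟨σ, hσ⟩

theorem State.Invariant.pos_le_idxOf (h : s.Invariant I n r) {a : A} {b : B}
    (hb : b ∈ I.menList a) (hrej : ¬ ∃ σ, (a, b, σ) ∈ s.rejections) (i : Fin 2) :
    s.pos (a, i) ≤ (I.menList a).idxOf b := by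
  rw [h.pos_eq]
  exact (Nat.mod_le _ _).trans (h.rejections_le_idxOf hb hrej i)

theorem State.IsOutput.isStable (hM : s.IsOutput I M) (h : s.Invariant I n r)
    (hfin : s.finished I) : I.IsStable M := by
  refine ⟨⟨hM.1.1.1.trans State.accepted_subset_edges, hM.1.1.2⟩, ?_⟩
  rintro a b ⟨hab, habM, hman, hwoman⟩
  have hb := Market.mem_edges.1 hab
  by_cases hrej : ∃ σ, (a, b, σ) ∈ s.rejections
  · -- A woman who has rejected `a` is matched, and not to a man worse than `a`.
    obtain ⟨σ, hσ⟩ := hrej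
    have hbound := h.bounded a b σ hσ
    obtain ⟨a', ha'⟩ := hM.exists_mem_of_woman h hbound.1
    obtain ⟨i, hi⟩ := State.mem_accepted.1 (hM.1.1.1 ha')
    have hkey := hbound.2 _ hi
    have hlt : I.rank b a < I.rank b a' := hwoman a' ha'
    have hσ3 : σ.maxLevel ≤ 3 := by cases σ <;> simp [Status.maxLevel]
    unfold State.key at hkey
    dsimp only at hkey
    omega
  · -- Otherwise both proposals of `a` are held by women whom he likes at least as much as `b`.
    have hbasic : s.status I a = .basic := by
      by_contra hs
      exact hrej ⟨_, State.rejected_of_status_ne_basic hb hs⟩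
    have hheld : ∀ i, (a, i) ∈ s.held := fun i =>
      (hfin (a, i)).resolve_right fun hs => by simp [State.stopped, hbasic] at hs
    obtain ⟨c₀, hc₀⟩ := h.exists_mem_holds (hheld 0)
    obtain ⟨c₁, hc₁⟩ := h.exists_mem_holds (hheld 1)
    obtain ⟨d, hd⟩ := hM.exists_mem_of_man h hc₀ hc₁
    obtain ⟨i, hi⟩ := State.mem_accepted.1 (hM.1.1.1 hd)
    have hlt : (I.menList a).idxOf b < (I.menList a).idxOf d := hman d hd
    have hpos := State.idxOf_eq_pos_of_mem_holds hi
    have hle := h.pos_le_idxOf hb hrej i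
    dsimp only at hpos
    omega

end Output

/-! ### Discharging -/

section StablePartner

variable {A B : Type*} [Fintype A] [Fintype B] [DecidableEq B] {I : Market A B}
  {N : Finset (A × B)}

/-- The man `a` strictly prefers his partner in `N` to `b`. -/
def Market.PrefersPartner (I : Market A B) (N : Finset (A × B)) (a : A) (b : B) : Prop :=
  ∃ b', (a, b') ∈ N ∧ I.manPrefers a b' b

/-- If a woman prefers an acceptable man to her partner in a stable matching, then he prefers his
own partner to her. -/
theorem Market.IsStable.prefersPartner (hN : I.IsStable N) {a x : A} {b : B} (hab : (a, b) ∈ N)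
    (hx : b ∈ I.menList x) (hlt : I.rank b x < I.rank b a) : I.PrefersPartner N x b := by
  by_contra hpref
  have hxb : (x, b) ∉ N := by
    intro hxb
    have : x = a := congrArg Prod.fst (hN.1.2 _ hxb _ hab (Or.inr rfl))
    rw [this] at hlt
    exact lt_irrefl _ hlt
  refine hN.2 x b ⟨Market.mem_edges.2 hx, hxb, fun b' hb' => ?_, fun a' ha' => ?_⟩
  · by_contra hnot
    refine hpref ⟨b', hb', lt_of_le_of_ne (not_lt.1 hnot) fun heq => hxb ?_⟩
    rwa [← (List.idxOf_inj (Market.mem_edges.1 (hN.1.1 hb'))).1 heq]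
  · obtain rfl : a' = a := congrArg Prod.fst (hN.1.2 _ ha' _ hab (Or.inr rfl))
    exact hlt

theorem Market.not_prefersPartner (hN : IsMatching I.edges N) {a : A} {b c : B}
    (hab : (a, b) ∈ N) (hle : (I.menList a).idxOf c ≤ (I.menList a).idxOf b) :
    ¬ I.PrefersPartner N a c := by
  rintro ⟨b', hb', hlt⟩
  obtain rfl : b' = b := congrArg Prod.snd (hN.2 _ hb' _ hab (Or.inl rfl))
  exact absurd hlt (not_lt.2 hle)

end StablePartner

section Shares

variable {A B : Type*} [Fintype B] [DecidableEq A] [DecidableEq B]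
variable {I : Market A B} {s : State A B} {N : Finset (A × B)}

open Classical in
/-- The part of the cost `9` of the edge `(a, b)` of a stable matching that is charged to the
woman `b`.  The rest is charged to the man `a`. -/
noncomputable def State.womanShare (I : Market A B) (s : State A B) (a : A) (b : B) : ℕ :=
  if s.stopped I a then 9
  else if s.Bounded I b (4 * I.rank b a + 2) then 5
  else if ∃ σ, (a, b, σ) ∈ s.rejections then 3
  else 0

open Classical in
/-- What a woman `b` of the vertex cover pays to a man `a` outside of it for a proposal of `a` that
she holds. -/
noncomputable def State.payment (I : Market A B) (s : State A B) (N : Finset (A × B))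
    (a : A) (b : B) : ℕ :=
  if s.status I a = .twoPromoted ∨ I.PrefersPartner N a b then 2
  else if ∃ σ, (a, b, σ) ∈ s.rejections then 4
  else 5

/-- What the matching `N` charges to the woman `b`. -/
noncomputable def State.womanCharge (I : Market A B) (s : State A B) (N : Finset (A × B))
    (b : B) : ℕ :=
  ∑ e ∈ N with e.2 = b, s.womanShare I e.1 e.2

/-- What the matching `N` charges to the man `a`. -/
noncomputable def State.manCharge (I : Market A B) (s : State A B) (N : Finset (A × B))
    (a : A) : ℕ :=
  ∑ e ∈ N with e.1 = a, (9 - s.womanShare I e.1 e.2)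

theorem State.womanShare_le (a : A) (b : B) : s.womanShare I a b ≤ 9 := by
  unfold State.womanShare
  split_ifs <;> omega

theorem State.payment_le (a : A) (b : B) : s.payment I N a b ≤ 5 := by
  unfold State.payment
  split_ifs <;> omega

theorem State.two_le_payment (a : A) (b : B) : 2 ≤ s.payment I N a b := by
  unfold State.payment
  split_ifs <;> omega

theorem State.rejected_of_level_le_two {a : A} {b : B} (hb : b ∈ I.menList a)
    (h : s.level I b a ≤ 2) : ∃ σ, (a, b, σ) ∈ s.rejections := by
  by_contra hrej
  have hs : s.status I a = .basic := by
    by_contra hs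
    exact hrej ⟨_, State.rejected_of_status_ne_basic hb hs⟩
  simp [State.level, hs, hrej] at h

theorem State.status_of_level_eq_zero {a : A} {b : B} (h : s.level I b a = 0) :
    s.status I a = .twoPromoted := by
  unfold State.level at h
  split at h
  · assumption
  · omega
  · split at h <;> omega

theorem State.exists_of_womanCharge_ne_zero {b : B} (h : s.womanCharge I N b ≠ 0) :
    ∃ a, (a, b) ∈ N := by
  obtain ⟨⟨a, c⟩, he, -⟩ := Finset.exists_ne_zero_of_sum_ne_zero h
  obtain ⟨hab, rfl⟩ := Finset.mem_filter.1 he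
  exact ⟨a, hab⟩

theorem State.exists_of_manCharge_ne_zero {a : A} (h : s.manCharge I N a ≠ 0) :
    ∃ b, (a, b) ∈ N := by
  obtain ⟨⟨x, b⟩, he, -⟩ := Finset.exists_ne_zero_of_sum_ne_zero h
  obtain ⟨hab, rfl⟩ := Finset.mem_filter.1 he
  exact ⟨b, hab⟩

end Shares

section Discharging

variable {A B : Type*} [Fintype A] [Fintype B] [DecidableEq A] [DecidableEq B]
variable {I : Market A B} {n : ℕ} {s : State A B} {r : A × Fin 2 → ℕ} {M N : Finset (A × B)}

theorem State.womanCharge_eq (hN : IsMatching I.edges N) {a : A} {b : B} (hab : (a, b) ∈ N) :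
    s.womanCharge I N b = s.womanShare I a b := by
  have : (N.filter fun e => e.2 = b) = {(a, b)} := by
    ext e
    rw [Finset.mem_filter, Finset.mem_singleton]
    constructor
    · rintro ⟨he, h⟩
      exact hN.2 e he _ hab (Or.inr h)
    · rintro rfl
      exact ⟨hab, rfl⟩
  rw [State.womanCharge, this, Finset.sum_singleton]

theorem State.manCharge_eq (hN : IsMatching I.edges N) {a : A} {b : B} (hab : (a, b) ∈ N) :
    s.manCharge I N a = 9 - s.womanShare I a b := by
  have : (N.filter fun e => e.1 = a) = {(a, b)} := by
    ext e
    rw [Finset.mem_filter, Finset.mem_singleton]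
    constructor
    · rintro ⟨he, h⟩
      exact hN.2 e he _ hab (Or.inl h)
    · rintro rfl
      exact ⟨hab, rfl⟩
  rw [State.manCharge, this, Finset.sum_singleton]

theorem State.womanCharge_le (hN : IsMatching I.edges N) (b : B) : s.womanCharge I N b ≤ 9 := by
  by_cases h : s.womanCharge I N b = 0
  · omega
  · obtain ⟨a, ha⟩ := State.exists_of_womanCharge_ne_zero h
    rw [State.womanCharge_eq hN ha]
    exact State.womanShare_le a b

theorem State.sum_manCharge_add_sum_womanCharge :
    ∑ a, s.manCharge I N a + ∑ b, s.womanCharge I N b = 9 * N.card := by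
  unfold State.manCharge State.womanCharge
  rw [Finset.sum_fiberwise, Finset.sum_fiberwise, ← Finset.sum_add_distrib,
    Finset.sum_congr rfl fun e _ => Nat.sub_add_cancel (State.womanShare_le e.1 e.2),
    Finset.sum_const, smul_eq_mul, mul_comm]

theorem State.bounded_of_stopped (h : s.Invariant I n r) {a : A} {b : B} (hb : b ∈ I.menList a)
    (ha : s.stopped I a) : s.Bounded I b (4 * I.rank b a) :=
  h.bounded a b _ (ha.2 b hb)

/-- If a stopped man is the partner of `b`, then `b` holds only proposals of men who are
`2`-promoted or prefer their partners to her. -/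
theorem State.Invariant.of_partner_stopped (h : s.Invariant I n r) (hN : I.IsStable N) {a : A}
    {b : B} (hab : (a, b) ∈ N) (ha : s.stopped I a) {p : A × Fin 2} (hp : p ∈ s.holds I b) :
    s.status I p.1 = .twoPromoted ∨ I.PrefersPartner N p.1 b := by
  have hkey := (State.bounded_of_stopped h (Market.mem_edges.1 (hN.1.1 hab)) ha).2 p hp
  unfold State.key at hkey
  rcases Nat.lt_or_ge (I.rank b p.1) (I.rank b a) with hlt | hge
  · exact Or.inr (hN.prefersPartner hab (State.mem_menList_of_mem_holds hp) hlt)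
  · exact Or.inl (State.status_of_level_eq_zero (b := b) (by omega))

theorem State.Bounded.rejected_or_prefersPartner (hN : I.IsStable N) {a : A} {b : B}
    (hab : (a, b) ∈ N) (hb : s.Bounded I b (4 * I.rank b a + 2)) {p : A × Fin 2}
    (hp : p ∈ s.holds I b) :
    (∃ σ, (p.1, b, σ) ∈ s.rejections) ∨ I.PrefersPartner N p.1 b := by
  have hkey := hb.2 p hp
  have hmem := State.mem_menList_of_mem_holds hp
  unfold State.key at hkey
  rcases Nat.lt_or_ge (I.rank b p.1) (I.rank b a) with hlt | hge
  · exact Or.inr (hN.prefersPartner hab hmem hlt)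
  · exact Or.inl (State.rejected_of_level_le_two hmem (by omega))

/-- A woman can afford her charge and the payments for the proposals that she holds. -/
theorem State.Invariant.womanCharge_add_sum_payment_le (h : s.Invariant I n r)
    (hN : I.IsStable N) (b : B) :
    s.womanCharge I N b + ∑ p ∈ s.holds I b, s.payment I N p.1 b ≤ 13 := by
  have hsum : ∀ c, (∀ p ∈ s.holds I b, s.payment I N p.1 b ≤ c) →
      ∑ p ∈ s.holds I b, s.payment I N p.1 b ≤ 2 * c := fun c hc =>
    (Finset.sum_le_card_nsmul _ _ c hc).trans (Nat.mul_le_mul_right c (h.card_holds_le b))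
  have h5 := hsum 5 fun p _ => State.payment_le p.1 b
  by_cases hzero : s.womanCharge I N b = 0
  · omega
  obtain ⟨a, hab⟩ := State.exists_of_womanCharge_ne_zero hzero
  rw [State.womanCharge_eq hN.1 hab]
  unfold State.womanShare
  split_ifs with h9 hb
  · have := hsum 2 fun p hp => by
      rw [State.payment, if_pos (h.of_partner_stopped hN hab h9 hp)]
    omega
  · have := hsum 4 fun p hp => by
      unfold State.payment
      have := hb.rejected_or_prefersPartner hN hab hp
      split_ifs <;> first | omega | tauto
    omega
  · omega
  · omega

/-- Bounds on the charge to a woman who holds a proposal of a man that is not `2`-promoted and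
likes her at least as much as his partner. -/
theorem State.Invariant.womanCharge_le_of_mem_holds (h : s.Invariant I n r) (hN : I.IsStable N)
    {p : A × Fin 2} {b : B} (hp : p ∈ s.holds I b) (htwo : s.status I p.1 ≠ .twoPromoted)
    (hpref : ¬ I.PrefersPartner N p.1 b) :
    s.womanCharge I N b ≤ 5 ∧
      ((¬ ∃ σ, (p.1, b, σ) ∈ s.rejections) → s.womanCharge I N b ≤ 3) := by
  by_cases hzero : s.womanCharge I N b = 0
  · omega
  obtain ⟨a, hab⟩ := State.exists_of_womanCharge_ne_zero hzero
  rw [State.womanCharge_eq hN.1 hab]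
  unfold State.womanShare
  split_ifs with h9 hb
  · exact ((h.of_partner_stopped hN hab h9 hp).elim htwo hpref).elim
  · exact ⟨le_rfl, fun hrej => ((hb.rejected_or_prefersPartner hN hab hp).elim hrej hpref).elim⟩
  · omega
  · omega

/-- A woman who comes before both addresses of a man on his list has rejected him twice. -/
theorem State.Invariant.bounded_of_lt_pos (h : s.Invariant I n r) {a : A} {b : B}
    (hb : b ∈ I.menList a) (hlt : ∀ i, (I.menList a).idxOf b < s.pos (a, i)) :
    s.Bounded I b (4 * I.rank b a + 2) := by
  have hr : ∀ i, (I.menList a).idxOf b < r (a, i) := fun i =>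
    (hlt i).trans_le ((h.pos_eq (a, i)).trans_le (Nat.mod_le _ _))
  have hidx : (I.menList a)[(I.menList a).idxOf b % (I.menList a).length]? = some b := by
    rw [Nat.mod_eq_of_lt (List.idxOf_lt_length_of_mem hb), List.getElem?_idxOf hb]
  exact h.bounded_of_twice a 0 1 _ _ b (by simp) (hr 0) (hr 1) hidx hidx

/-- A basic man has a proposal whose present address has never rejected him. -/
theorem State.Invariant.exists_not_rejected (h : s.Invariant I n r) {a : A}
    (ha : s.status I a = .basic) {w : Fin 2 → B} (hw : ∀ i, (a, i) ∈ s.holds I (w i)) :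
    ∃ i, ¬ ∃ σ, (a, w i, σ) ∈ s.rejections := by
  obtain ⟨i, -, hi⟩ := Finset.exists_max_image Finset.univ (fun i => r (a, i))
    Finset.univ_nonempty
  have hlen : ∀ j, r (a, j) < (I.menList a).length := by
    intro j
    have := h.lt_of_not_stopped (a := a) (i := j) fun hs => by simp [State.stopped, ha] at hs
    simpa [ha, Status.num] using this
  refine ⟨i, ?_⟩
  rintro ⟨σ, hσ⟩
  obtain ⟨j, x, hx, hxw⟩ := h.exists_index _ _ _ hσ
  rw [Nat.mod_eq_of_lt (hx.trans (hlen j))] at hxw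
  have hiw := (State.mem_holds.1 (hw i)).2
  rw [h.pos_eq, Nat.mod_eq_of_lt (hlen i)] at hiw
  obtain ⟨h1, h2⟩ := List.getElem?_eq_some_iff.1 hxw
  obtain ⟨h3, h4⟩ := List.getElem?_eq_some_iff.1 hiw
  have : x = r (a, i) := (I.nodup a).getElem_inj_iff.1 (h2.trans h4.symm)
  have := hi j (Finset.mem_univ j)
  omega

/-- The charge to a man who has not stopped is covered by the payments for his proposals, and it
leaves room for half of the charges to the women who hold them. -/
theorem State.Invariant.manCharge_le (h : s.Invariant I n r) (hN : I.IsStable N) {a : A}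
    (ha : ¬ s.stopped I a) {w : Fin 2 → B} (hw : ∀ i, (a, i) ∈ s.holds I (w i)) :
    s.manCharge I N a ≤ ∑ i, s.payment I N a (w i) ∧
      2 * s.manCharge I N a + ∑ i, s.womanCharge I N (w i) ≤ 26 := by
  have hpay := fun i => State.two_le_payment (I := I) (s := s) (N := N) a (w i)
  have hcharge := fun i => State.womanCharge_le (s := s) hN.1 (w i)
  rw [Fin.sum_univ_two, Fin.sum_univ_two]
  by_cases hzero : s.manCharge I N a = 0
  · have := hcharge 0
    have := hcharge 1
    omega
  obtain ⟨b, hab⟩ := State.exists_of_manCharge_ne_zero hzero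
  have hb := Market.mem_edges.1 (hN.1.1 hab)
  -- What holds for a proposal that is not addressed to a woman worse than the partner `b`.
  have hgood : ∀ i, s.status I a ≠ .twoPromoted → s.pos (a, i) ≤ (I.menList a).idxOf b →
      (4 ≤ s.payment I N a (w i) ∧ s.womanCharge I N (w i) ≤ 5) ∧
      ((¬ ∃ σ, (a, w i, σ) ∈ s.rejections) →
        5 ≤ s.payment I N a (w i) ∧ s.womanCharge I N (w i) ≤ 3) := by
    intro i htwo hpos
    have hpref := Market.not_prefersPartner hN.1 hab (c := w i) (by
      have := State.idxOf_eq_pos_of_mem_holds (hw i)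
      dsimp only at this
      omega)
    obtain ⟨h5, h3⟩ := h.womanCharge_le_of_mem_holds hN (hw i) htwo hpref
    unfold State.payment
    rw [if_neg (by tauto)]
    refine ⟨⟨?_, h5⟩, fun hrej => ⟨?_, h3 hrej⟩⟩
    · split_ifs <;> omega
    · rw [if_neg hrej]
  rw [State.manCharge_eq hN.1 hab]
  have hp0 := hpay 0
  have hp1 := hpay 1
  have hc0 := hcharge 0
  have hc1 := hcharge 1
  unfold State.womanShare
  rw [if_neg ha]
  split_ifs with hbound hrej
  · omega
  · -- Share `6`: one of the proposals is addressed to `b` or to a better woman.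
    have htwo : s.status I a ≠ .twoPromoted := by
      intro htwo
      have hone : s.rejectedByAll I a .onePromoted := by
        revert htwo
        unfold State.status
        split_ifs <;> simp_all
      exact hbound ((h.bounded a b _ (hone b hb)).mono (by simp [Status.maxLevel]))
    obtain ⟨i, hi⟩ : ∃ i, s.pos (a, i) ≤ (I.menList a).idxOf b := by
      by_contra hcon
      push Not at hcon
      exact hbound (h.bounded_of_lt_pos hb hcon)
    have := (hgood i htwo hi).1
    obtain rfl | rfl : i = 0 ∨ i = 1 := by omega
    · omega
    · omega
  · -- Share `9`: this holds for both proposals, and one of the two women has not rejected `a`.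
    have hbasic : s.status I a = .basic := by
      by_contra hs
      exact hrej ⟨_, State.rejected_of_status_ne_basic hb hs⟩
    have hgood' := fun i => hgood i (by simp [hbasic]) (h.pos_le_idxOf hb hrej i)
    obtain ⟨i, hi⟩ := h.exists_not_rejected hbasic hw
    have h0 := (hgood' 0).1
    have h1 := (hgood' 1).1
    have := (hgood' i).2 hi
    obtain rfl | rfl : i = 0 ∨ i = 1 := by omega
    · omega
    · omega

/-- A maximum matching of the graph of the held proposals is within the factor `13 / 9` of every
stable matching. -/
theorem State.Invariant.nine_mul_card_le (h : s.Invariant I n r) (hfin : s.finished I)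
    (hM : IsMaximumMatching (s.accepted I) M) (hN : I.IsStable N) :
    9 * N.card ≤ 13 * M.card := by
  classical
  obtain ⟨C, D, hcover, hcard⟩ := hM.exists_vertexCover
  -- The held proposals, each together with the woman who holds it.
  let H : Finset ((A × Fin 2) × B) := Finset.univ.filter fun x => x.1 ∈ s.holds I x.2
  have hH : ∀ p b, (p, b) ∈ H ↔ p ∈ s.holds I b := fun p b => by simp [H]
  have hHcover : ∀ x ∈ H, x.1.1 ∈ C ∨ x.2 ∈ D := fun x hx =>
    hcover (x.1.1, x.2) (State.mem_accepted.2 ⟨x.1.2, (hH x.1 x.2).1 hx⟩)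
  let f : (A × Fin 2) × B → ℕ := fun x => if x.1.1 ∈ C then s.womanCharge I N x.2 else 0
  let g : (A × Fin 2) × B → ℕ := fun x => if x.2 ∈ D then 2 * s.payment I N x.1.1 x.2 else 0
  have hwoman : ∀ b, 2 * s.womanCharge I N b + ∑ x ∈ H with x.2 = b, g x ≤
      (if b ∈ D then 26 else 0) + ∑ x ∈ H with x.2 = b, f x := by
    intro b
    have himage : (H.filter fun x => x.2 = b) = (s.holds I b).image fun p => (p, b) := by
      ext ⟨p, c⟩
      simp only [Finset.mem_filter, Finset.mem_image, hH, Prod.mk.injEq]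
      constructor
      · rintro ⟨hp, rfl⟩
        exact ⟨p, hp, rfl, rfl⟩
      · rintro ⟨q, hq, rfl, rfl⟩
        exact ⟨hq, rfl⟩
    rw [himage, Finset.sum_image fun p _ q _ hpq => (Prod.ext_iff.1 hpq).1,
      Finset.sum_image fun p _ q _ hpq => (Prod.ext_iff.1 hpq).1]
    by_cases hb : b ∈ D
    · have := h.womanCharge_add_sum_payment_le hN b
      simp only [g, if_pos hb]
      rw [← Finset.mul_sum]
      omega
    · have hf : ∑ p ∈ s.holds I b, f (p, b) = (s.holds I b).card * s.womanCharge I N b := by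
        rw [Finset.sum_congr rfl fun p hp => if_pos ((hHcover (p, b) ((hH p b).2 hp)).resolve_right
          hb)]
        exact Finset.sum_const_nat fun _ _ => rfl
      simp only [g, if_neg hb, Finset.sum_const_zero, hf]
      by_cases hzero : s.womanCharge I N b = 0
      · simp [hzero]
      -- A woman who is charged something holds two proposals, each of which brings her half of it.
      obtain ⟨a, hab⟩ := State.exists_of_womanCharge_ne_zero hzero
      have htwo : 2 ≤ (s.holds I b).card := by
        rw [State.womanCharge_eq hN.1 hab] at hzero
        unfold State.womanShare at hzero
        split_ifs at hzero with h9 h5 h3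
        · exact (State.bounded_of_stopped h (Market.mem_edges.1 (hN.1.1 hab)) h9).1
        · exact h5.1
        · exact (h.bounded a b _ h3.choose_spec).1
        · exact (hzero rfl).elim
      have := Nat.mul_le_mul_right (s.womanCharge I N b) htwo
      omega
  have hman : ∀ a, 2 * s.manCharge I N a + ∑ x ∈ H with x.1.1 = a, f x ≤
      (if a ∈ C then 26 else 0) + ∑ x ∈ H with x.1.1 = a, g x := by
    intro a
    by_cases hstopped : s.stopped I a
    · have hzero : s.manCharge I N a = 0 := by
        by_contra hne
        obtain ⟨b, hab⟩ := State.exists_of_manCharge_ne_zero hne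
        rw [State.manCharge_eq hN.1 hab, State.womanShare, if_pos hstopped] at hne
        exact hne rfl
      rw [hzero]
      by_cases ha : a ∈ C
      · have hle : (H.filter fun x => x.1.1 = a).card ≤ 2 := by
          refine (Finset.card_le_card_of_injOn (t := (Finset.univ : Finset (Fin 2)))
            (fun x => x.1.2) (fun _ _ => Finset.mem_coe.2 (Finset.mem_univ _)) ?_).trans (by simp)
          rintro ⟨⟨x, i⟩, b⟩ hx ⟨⟨y, j⟩, c⟩ hy hij
          obtain ⟨hxb, hxa⟩ := Finset.mem_filter.1 (Finset.mem_coe.1 hx)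
          obtain ⟨hyc, hya⟩ := Finset.mem_filter.1 (Finset.mem_coe.1 hy)
          dsimp only at hxa hya hij
          subst hxa hya hij
          rw [State.eq_of_mem_holds ((hH _ _).1 hxb) ((hH _ _).1 hyc)]
        have hsum : ∑ x ∈ H with x.1.1 = a, f x ≤ (H.filter fun x => x.1.1 = a).card • 9 := by
          refine Finset.sum_le_card_nsmul _ _ 9 fun x _ => ?_
          have := State.womanCharge_le (s := s) hN.1 x.2
          simp only [f]
          split_ifs <;> omega
        rw [if_pos ha]
        rw [smul_eq_mul] at hsum
        omega
      · rw [Finset.sum_eq_zero fun x hx => if_neg (by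
          rw [(Finset.mem_filter.1 hx).2]
          exact ha)]
        omega
    · have hheld : ∀ i, (a, i) ∈ s.held := fun i => (hfin (a, i)).resolve_right hstopped
      choose w hw using fun i => h.exists_mem_holds (hheld i)
      have himage : (H.filter fun x => x.1.1 = a) = Finset.univ.image fun i => ((a, i), w i) := by
        ext ⟨⟨y, i⟩, c⟩
        simp only [Finset.mem_filter, Finset.mem_image, hH, Prod.mk.injEq, Finset.mem_univ,
          true_and]
        constructor
        · rintro ⟨hp, rfl⟩
          exact ⟨i, ⟨rfl, rfl⟩, State.eq_of_mem_holds (hw i) hp⟩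
        · rintro ⟨j, ⟨rfl, rfl⟩, rfl⟩
          exact ⟨hw _, rfl⟩
      have hinj : Function.Injective fun i : Fin 2 => ((a, i), w i) := fun i j hij =>
        congrArg (fun x => x.1.2) hij
      obtain ⟨h1, h2⟩ := h.manCharge_le hN hstopped hw
      rw [himage, Finset.sum_image hinj.injOn, Finset.sum_image hinj.injOn]
      by_cases ha : a ∈ C
      · simp only [f, if_pos ha]
        omega
      · have hD : ∀ i, w i ∈ D := fun i =>
          (hHcover ((a, i), w i) ((hH _ _).2 (hw i))).resolve_left ha
        simp only [f, g, if_neg ha, hD, if_true, Finset.sum_const_zero]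
        rw [← Finset.mul_sum]
        omega
  have h1 := Finset.sum_le_sum fun b (_ : b ∈ Finset.univ) => hwoman b
  have h2 := Finset.sum_le_sum fun a (_ : a ∈ Finset.univ) => hman a
  rw [Finset.sum_add_distrib, Finset.sum_add_distrib, Finset.sum_fiberwise,
    Finset.sum_fiberwise, ← Finset.mul_sum, Finset.sum_ite_mem, Finset.univ_inter,
    Finset.sum_const, smul_eq_mul] at h1 h2
  have h3 := State.sum_manCharge_add_sum_womanCharge (I := I) (s := s) (N := N)
  omega

end Discharging

end StableMarriage

open StableMarriage in
theorem theorem2 {A B : Type*} [Fintype A] [Fintype B] [DecidableEq A] [DecidableEq B]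
    (I : Market A B) :
    -- every run of the proposal phase makes at most `6 |E|` proposals
    (∀ (n : ℕ) (s : State A B), Run I n s → n ≤ 6 * I.edges.card) ∧
    -- a run never gets stuck before the proposal phase has ended
    (∀ (n : ℕ) (s : State A B), Run I n s → ¬ s.finished I → ∃ t, Step I s t) ∧
    -- when the proposal phase has ended, there is a matching to output, and every such matching
    -- is stable and within the factor `13 / 9` of the optimum
    (∀ (n : ℕ) (s : State A B), Run I n s → s.finished I →
      (∃ M, s.IsOutput I M) ∧
      ∀ M, s.IsOutput I M → I.IsStable M ∧
        ∀ OPT, I.IsMaximumStable OPT → (OPT.card : ℚ) ≤ 13 / 9 * (M.card : ℚ)) := by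
  refine ⟨fun n s h => ?_, fun n s h hfin => ?_, fun n s h hfin => ?_⟩
  · obtain ⟨r, hr⟩ := h.exists_invariant
    exact hr.le_six_mul_card_edges
  · obtain ⟨r, hr⟩ := h.exists_invariant
    exact State.exists_step hfin hr.pos_lt
  · obtain ⟨r, hr⟩ := h.exists_invariant
    refine ⟨hr.exists_isOutput, fun M hM => ⟨hM.isStable hr hfin, fun OPT hOPT => ?_⟩⟩
    have : ((9 * OPT.card : ℕ) : ℚ) ≤ ((13 * M.card : ℕ) : ℚ) :=
      Nat.cast_le.2 (hr.nine_mul_card_le hfin hM.1 hOPT.1)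
    push_cast at this
    linarith
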